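/- Let $m \ge 1$ and $n \ge 0$ be integers. A layer-rainbow latin cube of order $n$ is an $n\times n\times n$ array filled with $n^2$ symbols such that every layer (the set of cells obtained by fixing one of the three coordinates) contains every symbol exactly once. Take the symbols of a cube of order $n$ to be $0,1,\dots,n^2-1$, so that for $m<n$ the symbols of a cube of order $m$ are among those of a cube of order $n$. A cube $M$ of order $n$ is a proper extension of a cube $L$ of order $m$ if $m<n$ and the $m\times m\times m$ corner subarray of $M$ (all three coordinates among the first $m$) agrees cell by cell with $L$. Then for every layer-rainbow latin cube $L$ of order $m$: there is a layer-rainbow latin cube of order $n$ that properly extends $L$ if and only if $n\ge 2m$. -/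

import Mathlib

/-- An `n × n × n` array filled with the `n ^ 2` symbols `0, …, n ^ 2 - 1`. -/
abbrev CubeArray (n : ℕ) : Type := Fin n → Fin n → Fin n → Fin (n ^ 2)

/-- A layer-rainbow latin cube of order `n`: every layer (obtained by fixing one of the three
coordinates) contains every symbol exactly once. -/
structure IsLayerRainbow {n : ℕ} (L : CubeArray n) : Prop where
  layer_fst : ∀ i : Fin n, ∀ s : Fin (n ^ 2), ∃! p : Fin n × Fin n, L i p.1 p.2 = s
  layer_snd : ∀ j : Fin n, ∀ s : Fin (n ^ 2), ∃! p : Fin n × Fin n, L p.1 j p.2 = s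
  layer_trd : ∀ k : Fin n, ∀ s : Fin (n ^ 2), ∃! p : Fin n × Fin n, L p.1 p.2 k = s

/-- `M` is a proper extension of `L`: its order is larger, and every cell of the
`m × m × m` corner subarray of `M` contains the same symbol as the corresponding cell of `L`. -/
def ProperlyExtends {m n : ℕ} (L : CubeArray m) (M : CubeArray n) : Prop :=
  ∃ h : m < n, ∀ i j k : Fin m,
    (M (Fin.castLE h.le i) (Fin.castLE h.le j) (Fin.castLE h.le k) : ℕ) = (L i j k : ℕ)

/-!
Necessity. Outside the corner, a symbol `s < m ^ 2` never lies in a layer that meets the corner,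
since that layer already contains `s` inside the corner. So in a layer disjoint from the corner the
`m ^ 2` old symbols occupy distinct cells of an `(n - m) × (n - m)` square, whence `m ≤ n - m`.

Sufficiency. Put `r = n - m ≥ m`. The proof is by amalgamation and detachment, as in Baranyai's
theorem. Merge the `m` old coordinates of each direction into one point and the `r` new ones into
another, so that a cell outside the corner is known only by its type, one of seven. How many cells
of each type a symbol gets is fixed for a new symbol by the numbers `a₀, a₁, a₂` of its cells with
exactly two old coordinates. Each of them has to sum to `m ^ 2 * r` over the new symbols, with
`2 * m - r ≤ a₀ + a₁ + a₂ ≤ m` for each symbol. For `m ≤ r` the average of `a₀ + a₁ + a₂` satisfies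
these bounds, so distributing the cells evenly achieves them (`exists_balanced_triples`).

The merged points are then split, one direction at a time. The cells at a merged point of weight `w`
form a bipartite multigraph between symbols and types in which each symbol present has degree `w`
and each type has degree divisible by `w`. By Hall's theorem it decomposes into `w` classes that
contain each symbol once and an equal share of each type (`exists_equitable_split`); the classes
are the layers. After three splittings each cell outside the corner arises exactly once, and no
layer contains a symbol twice.
-/

/-! ### Necessity -/

theorem two_mul_le_of_properlyExtends {m n : ℕ} {L : CubeArray m} (hL : IsLayerRainbow L)
    {M : CubeArray n} (hM : IsLayerRainbow M) (h : ProperlyExtends L M) : 2 * m ≤ n := by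
  obtain ⟨hmn, hLM⟩ := h
  have hsq : m ^ 2 ≤ n ^ 2 := Nat.pow_le_pow_left hmn.le 2
  -- `p s` is the position of the symbol `s < m ^ 2` in the layer of `M` with first coordinate `m`,
  -- the first layer outside the corner.
  choose p hp using fun s : Fin (m ^ 2) => (hM.layer_fst ⟨m, hmn⟩ (Fin.castLE hsq s)).exists
  -- If the second coordinate were less than `m`, then `s` would also occur in that layer inside
  -- the corner, where the first coordinate is less than `m`.
  have hp2 : ∀ s, m ≤ ((p s).1 : ℕ) := by
    intro s
    by_contra! hlt
    obtain ⟨q, hq, -⟩ := hL.layer_snd ⟨(p s).1, hlt⟩ s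
    have hq' : M (Fin.castLE hmn.le q.1) (p s).1 (Fin.castLE hmn.le q.2) = Fin.castLE hsq s := by
      apply Fin.ext
      have := hLM q.1 ⟨(p s).1, hlt⟩ q.2
      rw [hq] at this
      exact this
    have := (hM.layer_snd (p s).1 (Fin.castLE hsq s)).unique
      (y₁ := (⟨m, hmn⟩, (p s).2)) (y₂ := (Fin.castLE hmn.le q.1, Fin.castLE hmn.le q.2)) (hp s) hq'
    have h1 := congrArg (fun a => (a.1 : ℕ)) this
    have h2 := q.1.isLt
    simp at h1
    omega
  have hp3 : ∀ s, m ≤ ((p s).2 : ℕ) := by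
    intro s
    by_contra! hlt
    obtain ⟨q, hq, -⟩ := hL.layer_trd ⟨(p s).2, hlt⟩ s
    have hq' : M (Fin.castLE hmn.le q.1) (Fin.castLE hmn.le q.2) (p s).2 = Fin.castLE hsq s := by
      apply Fin.ext
      have := hLM q.1 q.2 ⟨(p s).2, hlt⟩
      rw [hq] at this
      exact this
    have := (hM.layer_trd (p s).2 (Fin.castLE hsq s)).unique
      (y₁ := (⟨m, hmn⟩, (p s).1)) (y₂ := (Fin.castLE hmn.le q.1, Fin.castLE hmn.le q.2)) (hp s) hq'
    have h1 := congrArg (fun a => (a.1 : ℕ)) this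
    have h2 := q.1.isLt
    simp at h1
    omega
  let g : Fin (m ^ 2) → Fin (n - m) × Fin (n - m) := fun s =>
    (⟨(p s).1 - m, by have := (p s).1.isLt; omega⟩, ⟨(p s).2 - m, by have := (p s).2.isLt; omega⟩)
  have hg : Function.Injective g := by
    intro s s' hs
    have e1 : ((p s).1 : ℕ) - m = (p s').1 - m := congrArg (fun a => (a.1 : ℕ)) hs
    have e2 : ((p s).2 : ℕ) - m = (p s').2 - m := congrArg (fun a => (a.2 : ℕ)) hs
    have a1 := hp2 s
    have a2 := hp2 s'
    have a3 := hp3 s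
    have a4 := hp3 s'
    have hpp : p s = p s' := Prod.ext (Fin.ext (by omega)) (Fin.ext (by omega))
    have h1 := hp s
    rw [hpp, hp s'] at h1
    exact (Fin.castLE_injective hsq h1).symm
  have hcard := Fintype.card_le_of_injective g hg
  simp only [Fintype.card_fin, Fintype.card_prod, ← sq] at hcard
  have := (Nat.pow_le_pow_iff_left two_ne_zero).1 hcard
  omega

/-! ### Equitable splitting of bipartite multigraphs -/

open Finset in
/-- Regard each `e ∈ A` as an edge joining `c e` to `t e` in a bipartite multigraph in which every
colour that occurs has degree `r` and every type `τ` has degree `r * k τ`. Some set of edges then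
meets each of these colours once and each type `τ` exactly `k τ` times. -/
theorem exists_transversal {E C T : Type*} [DecidableEq E] [DecidableEq C] [DecidableEq T]
    {r : ℕ} (hr : 0 < r) (A : Finset E) (c : E → C) (t : E → T) (k : T → ℕ)
    (hc : ∀ e ∈ A, #{e' ∈ A | c e' = c e} = r) (ht : ∀ τ, #{e ∈ A | t e = τ} = r * k τ) :
    ∃ M ⊆ A, (∀ e ∈ A, #{e' ∈ M | c e' = c e} = 1) ∧ ∀ τ, #{e ∈ M | t e = τ} = k τ := by
  let S := A.image c
  have hS : ∀ s ∈ S, #{e ∈ A | c e = s} = r := by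
    intro s hs
    obtain ⟨e, he, rfl⟩ := mem_image.1 hs
    exact hc e he
  -- Hall's theorem is applied with `k τ` slots `(τ, 0), …, (τ, k τ - 1)` for each type `τ`.
  let N : S → Finset (Σ _ : T, ℕ) := fun s =>
    ({e ∈ A | c e = s}.image t).sigma fun τ => range (k τ)
  have hall : ∀ B : Finset S, #B ≤ #(B.biUnion N) := by
    intro B
    let Q : Finset T := B.biUnion fun s => {e ∈ A | c e = s}.image t
    have hQ : B.biUnion N = Q.sigma fun τ => range (k τ) := by
      ext ⟨τ, j⟩
      simp only [mem_biUnion, mem_sigma, N, Q]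
      constructor
      · rintro ⟨s, h1, h2, h3⟩; exact ⟨⟨s, h1, h2⟩, h3⟩
      · rintro ⟨⟨s, h1, h2⟩, h3⟩; exact ⟨s, h1, h2, h3⟩
    have hsub : (B.biUnion fun s : S => {e ∈ A | c e = s.1}) ⊆ {e ∈ A | t e ∈ Q} := by
      intro e he
      obtain ⟨s, hs, he⟩ := mem_biUnion.1 he
      have he' := mem_filter.1 he
      exact mem_filter.2 ⟨he'.1, mem_biUnion.2 ⟨s, hs, mem_image_of_mem t he⟩⟩
    have h1 : #(B.biUnion fun s : S => {e ∈ A | c e = s.1}) = #B * r := by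
      rw [card_biUnion]
      · rw [sum_congr rfl fun s _ => hS s.1 s.2, sum_const, smul_eq_mul]
      · intro s _ s' _ hss
        refine disjoint_left.2 fun e he he' => hss (Subtype.ext ?_)
        rw [← (mem_filter.1 he).2, ← (mem_filter.1 he').2]
    have h2 : #{e ∈ A | t e ∈ Q} = r * ∑ τ ∈ Q, k τ := by
      rw [card_eq_sum_card_fiberwise (f := t) (s := {e ∈ A | t e ∈ Q}) (t := Q)
        (fun e he => (mem_filter.1 he).2), mul_sum]
      refine sum_congr rfl fun τ hτ => ?_
      rw [← ht τ, filter_filter]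
      congr 1
      refine filter_congr fun e _ => ⟨fun h => h.2, fun h => ⟨h ▸ hτ, h⟩⟩
    have h3 := card_le_card hsub
    rw [h1, h2, mul_comm] at h3
    rw [hQ, card_sigma]
    simpa using Nat.le_of_mul_le_mul_left h3 hr
  obtain ⟨g, hg, hgN⟩ := (Finset.all_card_le_biUnion_card_iff_exists_injective N).1 hall
  have hex : ∀ s : S, ∃ e ∈ A, c e = s ∧ t e = (g s).1 := by
    intro s
    obtain ⟨e, he, h⟩ := mem_image.1 (mem_sigma.1 (hgN s)).1
    exact ⟨e, (mem_filter.1 he).1, (mem_filter.1 he).2, h⟩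
  choose ε hεA hεc hεt using hex
  have hεi : Function.Injective ε := fun s s' h => Subtype.ext (by rw [← hεc s, ← hεc s', h])
  let M : Finset E := univ.image ε
  have hMA : M ⊆ A := by
    intro e he
    obtain ⟨s, -, rfl⟩ := mem_image.1 he
    exact hεA s
  refine ⟨M, hMA, ?_, ?_⟩
  · intro e he
    rw [card_eq_one]
    refine ⟨ε ⟨c e, mem_image_of_mem c he⟩, ?_⟩
    ext e'
    simp only [mem_filter, mem_singleton, M, mem_image, mem_univ, true_and]
    constructor
    · rintro ⟨⟨s, rfl⟩, h⟩
      congr 1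
      exact Subtype.ext ((hεc s).symm.trans h)
    · rintro rfl
      exact ⟨⟨_, rfl⟩, hεc _⟩
  · have hle : ∀ τ, #{e ∈ M | t e = τ} ≤ k τ := by
      intro τ
      have h1 : #{e ∈ M | t e = τ} ≤ #{s : S | (g s).1 = τ} := by
        have : {e ∈ M | t e = τ} ⊆ image ε {s : S | (g s).1 = τ} := by
          intro e he
          obtain ⟨he, h⟩ := mem_filter.1 he
          obtain ⟨s, -, rfl⟩ := mem_image.1 he
          exact mem_image_of_mem _ (mem_filter.2 ⟨mem_univ _, by rw [← hεt, h]⟩)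
        exact (card_le_card this).trans card_image_le
      refine h1.trans ?_
      rw [← card_range (k τ)]
      refine card_le_card_of_injOn (fun s => (g s).2) ?_ ?_
      · intro s hs
        have h2 := (mem_sigma.1 (hgN s)).2
        rwa [(mem_filter.1 hs).2] at h2
      · intro s hs s' hs' h
        refine hg (Sigma.ext ?_ (heq_of_eq h))
        rw [(mem_filter.1 hs).2, (mem_filter.1 hs').2]
    -- Counting the edges by types and by colours shows that no slot is left unused.
    have hA : #A = r * ∑ τ ∈ A.image t, k τ := by
      rw [card_eq_sum_card_image t A, mul_sum]
      exact sum_congr rfl fun τ _ => ht τ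
    have hA' : #A = r * #M := by
      rw [card_eq_sum_card_image c A, sum_congr rfl hS, sum_const, smul_eq_mul, mul_comm,
        card_image_of_injective _ hεi, card_univ, Fintype.card_coe]
    have hM : #M = ∑ τ ∈ A.image t, #{e ∈ M | t e = τ} :=
      card_eq_sum_card_fiberwise fun e he => mem_image_of_mem t (hMA he)
    have heq : ∑ τ ∈ A.image t, #{e ∈ M | t e = τ} = ∑ τ ∈ A.image t, k τ := by
      rw [← hM]
      exact Nat.eq_of_mul_eq_mul_left hr (hA'.symm.trans hA)
    intro τ
    by_cases hτ : τ ∈ A.image t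
    · exact (sum_eq_sum_iff_of_le fun τ _ => hle τ).1 heq τ hτ
    · have h0 : #{e ∈ A | t e = τ} = 0 := by
        rw [card_eq_zero, filter_eq_empty_iff]
        exact fun e he h => hτ (h ▸ mem_image_of_mem t he)
      rw [ht τ] at h0
      have := hle τ
      have := (Nat.mul_eq_zero.1 h0).resolve_left hr.ne'
      omega

open Finset in
/-- The edges can be divided into `r` classes so that each class contains one edge of each colour
and `k τ` edges of each type `τ`. The case `k τ = 1` is König's edge-colouring theorem for regular
bipartite multigraphs. -/
theorem exists_equitable_split {E C T : Type*} [DecidableEq E] [DecidableEq C] [DecidableEq T]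
    (r : ℕ) (A : Finset E) (c : E → C) (t : E → T) (k : T → ℕ)
    (hc : ∀ e ∈ A, #{e' ∈ A | c e' = c e} = r) (ht : ∀ τ, #{e ∈ A | t e = τ} = r * k τ) :
    ∃ f : E → ℕ, (∀ e ∈ A, f e < r) ∧ (∀ e ∈ A, ∀ e' ∈ A, c e = c e' → f e = f e' → e = e') ∧
      ∀ τ, ∀ i < r, #{e ∈ A | t e = τ ∧ f e = i} = k τ := by
  induction r generalizing A with
  | zero =>
    have hA : ∀ e, e ∉ A := by
      intro e he
      have := hc e he
      rw [card_eq_zero, filter_eq_empty_iff] at this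
      exact this he rfl
    exact ⟨fun _ => 0, fun e he => (hA e he).elim, fun e he => (hA e he).elim,
      fun τ i hi => (Nat.not_lt_zero i hi).elim⟩
  | succ r ih =>
    obtain ⟨M, hMA, hMc, hMt⟩ := exists_transversal r.succ_pos A c t k hc ht
    have hsd : ∀ (p : E → Prop) [DecidablePred p],
        #{e ∈ A \ M | p e} + #{e ∈ M | p e} = #{e ∈ A | p e} := by
      intro p _
      rw [← card_union_of_disjoint (disjoint_filter_filter sdiff_disjoint), ← filter_union,
        sdiff_union_of_subset hMA]
    obtain ⟨f, hf, hfc, hft⟩ := ih (A \ M)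
      (fun e he => by
        have he := (mem_sdiff.1 he).1
        have h1 := hsd fun e' => c e' = c e
        have h2 := hMc e he
        have h3 := hc e he
        omega)
      (fun τ => by
        have h1 := hsd fun e => t e = τ
        have h2 := hMt τ
        have h3 := ht τ
        rw [add_mul, one_mul] at h3
        omega)
    have hMi : ∀ e ∈ M, ∀ e' ∈ M, c e = c e' → e = e' := by
      intro e he e' he' h
      obtain ⟨a, ha⟩ := card_eq_one.1 (hMc e (hMA he))
      have h1 : e ∈ ({a} : Finset E) := ha ▸ mem_filter.2 ⟨he, rfl⟩
      have h2 : e' ∈ ({a} : Finset E) := ha ▸ mem_filter.2 ⟨he', h.symm⟩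
      rw [mem_singleton.1 h1, mem_singleton.1 h2]
    refine ⟨fun e => if e ∈ M then r else f e, ?_, ?_, ?_⟩
    · intro e he
      by_cases h : e ∈ M
      · simp [h]
      · simp only [h, if_false]
        exact (hf e (mem_sdiff.2 ⟨he, h⟩)).trans r.lt_succ_self
    · intro e he e' he' hcc hff
      by_cases h : e ∈ M <;> by_cases h' : e' ∈ M <;> simp only [h, h', if_true, if_false] at hff
      · exact hMi e h e' h' hcc
      · have := hf e' (mem_sdiff.2 ⟨he', h'⟩)
        omega
      · have := hf e (mem_sdiff.2 ⟨he, h⟩)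
        omega
      · exact hfc e (mem_sdiff.2 ⟨he, h⟩) e' (mem_sdiff.2 ⟨he', h'⟩) hcc hff
    · intro τ i hi
      rcases Nat.lt_succ_iff_lt_or_eq.1 hi with hi | rfl
      · rw [← hft τ i hi]
        congr 1
        ext e
        simp only [mem_filter, mem_sdiff]
        by_cases h : e ∈ M
        · simp only [h, if_true]
          constructor
          · rintro ⟨-, -, h⟩; omega
          · tauto
        · simp [h]
      · rw [← hMt τ]
        congr 1
        ext e
        simp only [mem_filter]
        by_cases h : e ∈ M
        · simp [h, hMA h]
        · simp only [h, if_false]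
          constructor
          · rintro ⟨h1, -, h2⟩
            have := hf e (mem_sdiff.2 ⟨h1, h⟩)
            omega
          · tauto

open Finset in
/-- Every edge `e` lies at one of two amalgamated vertices, `b e`, of weight `w (b e)`. Each of them
is split into `w β` vertices: a colour class that meets it has `w β` edges there, and these go to
distinct new vertices, while the edges of each type are shared equally among them. -/
theorem exists_coordinate {E C T : Type*} [Fintype E] [DecidableEq E] [DecidableEq C]
    [DecidableEq T] (w : Bool → ℕ) (b : E → Bool) (c : E → C) (t : E → T) (k : T → Bool → ℕ)
    (hc : ∀ e, #{e' | c e' = c e ∧ b e' = b e} = w (b e))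
    (ht : ∀ τ β, #{e | t e = τ ∧ b e = β} = w β * k τ β) :
    ∃ f : E → ℕ, (∀ e, f e < w (b e)) ∧
      (∀ e e', c e = c e' → b e = b e' → f e = f e' → e = e') ∧
      ∀ τ β, ∀ i < w β, #{e | t e = τ ∧ b e = β ∧ f e = i} = k τ β := by
  have key := fun β => exists_equitable_split (w β) {e | b e = β} c t (fun τ => k τ β)
    (fun e he => by
      rw [filter_filter, ← (mem_filter.1 he).2, ← hc e]
      simp only [and_comm])
    (fun τ => by rw [filter_filter, ← ht τ β]; simp only [and_comm])
  choose f hf hfc hft using key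
  refine ⟨fun e => f (b e) e, fun e => hf _ e (by simp), fun e e' h1 h2 h3 => ?_, ?_⟩
  · refine hfc (b e) e (by simp) e' (by simp [h2]) h1 ?_
    have h3 : f (b e) e = f (b e') e' := h3
    rw [h3, h2]
  · intro τ β i hi
    rw [← hft β τ i hi, filter_filter]
    congr 1
    refine filter_congr fun e _ => ?_
    constructor
    · rintro ⟨h1, rfl, h2⟩; exact ⟨rfl, h1, h2⟩
    · rintro ⟨rfl, h1, h2⟩; exact ⟨h1, rfl, h2⟩

/-! ### Type counts for the new symbols -/

open Finset in
/-- The numbers of cells of a new symbol `j` with exactly two coordinates below `m`, according to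
which two. The bounds on their sum make the remaining type counts of `j` nonnegative. -/
theorem exists_balanced_triples {m r : ℕ} (hmr : m ≤ r) :
    ∃ a : Fin 3 → Fin (r ^ 2 + 2 * m * r) → ℕ, (∀ l, ∑ j, a l j = m ^ 2 * r) ∧
      ∀ j, a 0 j + a 1 j + a 2 j ≤ m ∧ 2 * m ≤ r + (a 0 j + a 1 j + a 2 j) := by
  set N := r ^ 2 + 2 * m * r with hN
  set P := m ^ 2 * r with hP
  -- The `3 * P` cells to be distributed are dealt out cyclically, the `i`th one to the symbol
  -- `i % N`; they are of kind `0`, `1` or `2` according to the block `[l * P, (l + 1) * P)`.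
  -- This balances the totals, and both bounds below hold on average because `m ≤ r`.
  have hmul : ∀ (q : ℕ) (j : Fin N), #{i ∈ range (q * N) | i % N = j} = q := by
    intro q j
    have h0 : 0 < N := j.pos
    rw [← card_range q]
    symm
    refine card_bij (fun i _ => j + i * N) ?_ ?_ ?_
    · intro i hi
      have hi := mem_range.1 hi
      refine mem_filter.2 ⟨mem_range.2 ?_, ?_⟩
      · rw [card_range]
        have := Nat.mul_le_mul_right N (Nat.succ_le_of_lt hi)
        rw [Nat.succ_mul] at this
        have := j.isLt
        lia
      · rw [Nat.add_mul_mod_self_right, Nat.mod_eq_of_lt j.isLt]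
    · intro i _ i' _ h
      exact Nat.eq_of_mul_eq_mul_right h0 (Nat.add_left_cancel h)
    · intro i hi
      obtain ⟨h1, h2⟩ := mem_filter.1 hi
      have h1 := mem_range.1 h1
      refine ⟨i / N, mem_range.2 ?_, ?_⟩
      · rw [card_range] at h1
        exact Nat.div_lt_of_lt_mul (by rwa [mul_comm])
      · rw [← h2, mul_comm]
        exact Nat.mod_add_div i N
  have hdiv : ∀ l : ℕ, ∑ j : Fin N, #{i ∈ Ico (l * P) ((l + 1) * P) | i % N = j} = P := by
    intro l
    rcases Nat.eq_zero_or_pos r with rfl | hr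
    · simp [hP]
    have h0 : 0 < N := by positivity
    have := card_eq_sum_card_fiberwise (f := fun i => (⟨i % N, Nat.mod_lt i h0⟩ : Fin N))
      (s := Ico (l * P) ((l + 1) * P)) (t := univ) (fun _ _ => mem_coe.2 (mem_univ _))
    rw [Nat.card_Ico, ← Nat.sub_mul, Nat.add_sub_cancel_left, one_mul] at this
    simpa only [Fin.ext_iff] using this.symm
  refine ⟨fun l j => #{i ∈ Ico ((l : ℕ) * P) ((l + 1) * P) | i % N = j}, fun l => hdiv l, ?_⟩
  intro j
  have htot : #{i ∈ range (3 * P) | i % N = (j : ℕ)} =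
      #{i ∈ Ico (0 * P) ((0 + 1) * P) | i % N = (j : ℕ)}
      + #{i ∈ Ico (1 * P) ((1 + 1) * P) | i % N = (j : ℕ)}
      + #{i ∈ Ico (2 * P) ((2 + 1) * P) | i % N = (j : ℕ)} := by
    have e1 : range (3 * P) = Ico (0 * P) ((0 + 1) * P) ∪ Ico (1 * P) ((1 + 1) * P) ∪
        Ico (2 * P) ((2 + 1) * P) := by
      ext i; simp only [mem_range, mem_union, mem_Ico]; omega
    rw [e1, filter_union, filter_union, card_union_of_disjoint, card_union_of_disjoint]
    · refine disjoint_filter_filter (disjoint_left.2 fun i hi hi' => ?_)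
      simp only [mem_Ico] at hi hi'; omega
    · rw [← filter_union]
      refine disjoint_filter_filter (disjoint_left.2 fun i hi hi' => ?_)
      simp only [mem_Ico, mem_union] at hi hi'; omega
  have hmono : ∀ {u v : ℕ}, u ≤ v →
      #{i ∈ range u | i % N = (j : ℕ)} ≤ #{i ∈ range v | i % N = (j : ℕ)} := fun h =>
    card_le_card (filter_subset_filter _ (range_mono h))
  have hup : 3 * P ≤ m * N := by rw [hP, hN]; nlinarith [Nat.mul_le_mul_left (m * r) hmr]
  have hlo : (2 * m - r) * N ≤ 3 * P := by
    rcases le_total (2 * m) r with h | h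
    · simp [Nat.sub_eq_zero_of_le h]
    · obtain ⟨d, hd⟩ := Nat.exists_eq_add_of_le h
      obtain ⟨u, rfl⟩ := Nat.exists_eq_add_of_le hmr
      rw [hd, Nat.add_sub_cancel_left, hP, hN]
      obtain rfl : m = u + d := by omega
      nlinarith [Nat.zero_le (u * (u + d + u) * d), Nat.zero_le (u * u * (u + d + u))]
  have h1 := hmono hup
  have h2 := hmono hlo
  rw [hmul, htot] at h1
  rw [hmul, htot] at h2
  simp only [Fin.val_zero, Fin.val_one, Fin.val_two]
  omega

/-! ### Splitting all three coordinates -/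

/-- It suffices that no symbol occurs twice in a layer: by counting, it then occurs once. -/
theorem isLayerRainbow_of_bijective {n : ℕ} {E : Type*} [Fintype E]
    (pos : E ≃ Fin n × Fin n × Fin n) (col : E → Fin (n ^ 2))
    (h₁ : Function.Injective fun e => (col e, (pos e).1))
    (h₂ : Function.Injective fun e => (col e, (pos e).2.1))
    (h₃ : Function.Injective fun e => (col e, (pos e).2.2)) :
    IsLayerRainbow (fun x y z => col (pos.symm (x, y, z)) : CubeArray n) := by
  have hcard : Fintype.card E = Fintype.card (Fin (n ^ 2) × Fin n) := by
    rw [Fintype.card_congr pos]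
    simp only [Fintype.card_prod, Fintype.card_fin]
    ring
  have hsurj : ∀ {g : E → Fin (n ^ 2) × Fin n}, Function.Injective g → Function.Surjective g :=
    fun hg => ((Fintype.bijective_iff_injective_and_card _).2 ⟨hg, hcard⟩).2
  refine ⟨fun i s => ?_, fun i s => ?_, fun i s => ?_⟩
  · obtain ⟨e, he⟩ := hsurj h₁ (s, i)
    obtain ⟨rfl, rfl⟩ := Prod.ext_iff.1 he
    refine ⟨(pos e).2, by simp, fun q hq => ?_⟩
    have := @h₁ (pos.symm ((pos e).1, q)) e (by simpa using hq)
    simpa using congrArg (fun e => (pos e).2) this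
  · obtain ⟨e, he⟩ := hsurj h₂ (s, i)
    obtain ⟨rfl, rfl⟩ := Prod.ext_iff.1 he
    refine ⟨((pos e).1, (pos e).2.2), by simp, fun q hq => ?_⟩
    have := @h₂ (pos.symm (q.1, (pos e).2.1, q.2)) e (by simpa using hq)
    simpa using congrArg (fun e => ((pos e).1, (pos e).2.2)) this
  · obtain ⟨e, he⟩ := hsurj h₃ (s, i)
    obtain ⟨rfl, rfl⟩ := Prod.ext_iff.1 he
    refine ⟨((pos e).1, (pos e).2.1), by simp, fun q hq => ?_⟩
    have := @h₃ (pos.symm (q.1, q.2, (pos e).2.2)) e (by simpa using hq)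
    simpa using congrArg (fun e => ((pos e).1, (pos e).2.1)) this

open Finset in
/-- The three coordinates are split one after the other. In the second and third step the type of an
edge records the coordinates already found, so that the multiplicity of each type is divided by the
weight at each step and finally becomes `κ`. -/
theorem exists_three_coordinates {E C : Type*} [Fintype E] [DecidableEq E] [DecidableEq C]
    (w : Bool → ℕ) (κ : Bool → Bool → Bool → ℕ) (c : E → C) (b₁ b₂ b₃ : E → Bool)
    (h₁ : ∀ e, #{e' | c e' = c e ∧ b₁ e' = b₁ e} = w (b₁ e))
    (h₂ : ∀ e, #{e' | c e' = c e ∧ b₂ e' = b₂ e} = w (b₂ e))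
    (h₃ : ∀ e, #{e' | c e' = c e ∧ b₃ e' = b₃ e} = w (b₃ e))
    (ht : ∀ β₁ β₂ β₃, #{e | b₁ e = β₁ ∧ b₂ e = β₂ ∧ b₃ e = β₃} =
      w β₁ * (w β₂ * (w β₃ * κ β₁ β₂ β₃))) :
    ∃ f₁ f₂ f₃ : E → ℕ, (∀ e, f₁ e < w (b₁ e) ∧ f₂ e < w (b₂ e) ∧ f₃ e < w (b₃ e)) ∧
      (∀ e e', c e = c e' → b₁ e = b₁ e' → f₁ e = f₁ e' → e = e') ∧
      (∀ e e', c e = c e' → b₂ e = b₂ e' → f₂ e = f₂ e' → e = e') ∧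
      (∀ e e', c e = c e' → b₃ e = b₃ e' → f₃ e = f₃ e' → e = e') ∧
      ∀ β₁ β₂ β₃, ∀ i₁ < w β₁, ∀ i₂ < w β₂, ∀ i₃ < w β₃,
        #{e | ((b₁ e = β₁ ∧ f₁ e = i₁) ∧ b₂ e = β₂ ∧ f₂ e = i₂) ∧ b₃ e = β₃ ∧ f₃ e = i₃} =
          κ β₁ β₂ β₃ := by
  obtain ⟨f₁, hf₁, hi₁, hk₁⟩ := exists_coordinate w b₁ c (fun e => (b₂ e, b₃ e))
    (fun τ β₁ => w τ.1 * (w τ.2 * κ β₁ τ.1 τ.2)) h₁ (by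
      rintro ⟨β₂, β₃⟩ β₁
      rw [← ht]
      congr 1
      refine filter_congr fun e _ => ?_
      rw [Prod.mk.injEq]; tauto)
  obtain ⟨f₂, hf₂, hi₂, hk₂⟩ := exists_coordinate w b₂ c (fun e => ((b₁ e, f₁ e), b₃ e))
    (fun τ β₂ => if τ.1.2 < w τ.1.1 then w τ.2 * κ τ.1.1 β₂ τ.2 else 0) h₂ (by
      rintro ⟨⟨β₁, i₁⟩, β₃⟩ β₂
      dsimp only
      split_ifs with h
      · rw [← hk₁ (β₂, β₃) β₁ i₁ h]
        congr 1
        refine filter_congr fun e _ => ?_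
        simp only [Prod.mk.injEq]; tauto
      · rw [mul_zero, card_eq_zero, filter_eq_empty_iff]
        rintro e - ⟨he, -⟩
        simp only [Prod.mk.injEq] at he
        obtain ⟨⟨rfl, rfl⟩, -⟩ := he
        exact h (hf₁ e))
  obtain ⟨f₃, hf₃, hi₃, hk₃⟩ := exists_coordinate w b₃ c (fun e => ((b₁ e, f₁ e), b₂ e, f₂ e))
    (fun τ β₃ => if τ.1.2 < w τ.1.1 ∧ τ.2.2 < w τ.2.1 then κ τ.1.1 τ.2.1 β₃ else 0) h₃ (by
      rintro ⟨⟨β₁, i₁⟩, β₂, i₂⟩ β₃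
      dsimp only
      split_ifs with h
      · have := hk₂ ((β₁, i₁), β₃) β₂ i₂ h.2
        rw [if_pos h.1] at this
        rw [← this]
        congr 1
        refine filter_congr fun e _ => ?_
        simp only [Prod.mk.injEq]; tauto
      · rw [mul_zero, card_eq_zero, filter_eq_empty_iff]
        rintro e - ⟨he, -⟩
        simp only [Prod.mk.injEq] at he
        obtain ⟨⟨rfl, rfl⟩, rfl, rfl⟩ := he
        exact h ⟨hf₁ e, hf₂ e⟩)
  refine ⟨f₁, f₂, f₃, fun e => ⟨hf₁ e, hf₂ e, hf₃ e⟩, hi₁, hi₂, hi₃, ?_⟩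
  intro β₁ β₂ β₃ i₁ h1 i₂ h2 i₃ h3
  have := hk₃ ((β₁, i₁), β₂, i₂) β₃ i₃ h3
  rw [if_pos ⟨h1, h2⟩] at this
  rw [← this]
  congr 1
  refine filter_congr fun e _ => ?_
  simp only [Prod.mk.injEq]

/-! ### The amalgamated cube -/

/-- The number of cells outside the corner with a given symbol and a given type. The type of a cell
records for each coordinate whether it is less than `m` (`true`) or not (`false`). The symbols are
the `m ^ 2` symbols of the corner (`inl`) and the new ones (`inr`); the former need `r` more cells,
all without a coordinate below `m`. The counts for a new symbol are determined by the three numbers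
of cells with exactly two coordinates below `m`, because `m` of its cells lie in the old layers of
each direction and `r` in the new ones. -/
def typeCount (m r : ℕ) {N : ℕ} (a : Fin 3 → Fin N → ℕ) :
    Fin (m ^ 2) ⊕ Fin N → Bool → Bool → Bool → ℕ
  | .inl _, false, false, false => r
  | .inl _, _, _, _ => 0
  | .inr _, true, true, true => 0
  | .inr j, true, true, false => a 0 j
  | .inr j, true, false, true => a 1 j
  | .inr j, false, true, true => a 2 j
  | .inr j, true, false, false => m - (a 0 j + a 1 j)
  | .inr j, false, true, false => m - (a 0 j + a 2 j)
  | .inr j, false, false, true => m - (a 1 j + a 2 j)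
  | .inr j, false, false, false => r + (a 0 j + a 1 j + a 2 j) - 2 * m

/-- The cells outside the corner before their exact coordinates are known: each carries only a
symbol and a type, and there are `typeCount` many for each pair. -/
abbrev Edge (m r : ℕ) {N : ℕ} (a : Fin 3 → Fin N → ℕ) : Type :=
  Σ p : (Fin (m ^ 2) ⊕ Fin N) × Bool × Bool × Bool, Fin (typeCount m r a p.1 p.2.1 p.2.2.1 p.2.2.2)

open Finset in
theorem card_filter_sigma_fst {ι : Type*} [Fintype ι] (N : ι → ℕ) (P : ι → Prop)
    [DecidablePred P] : #{e : Σ p, Fin (N p) | P e.1} = ∑ p, if P p then N p else 0 := by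
  have : ({e : Σ p, Fin (N p) | P e.1} : Finset _) =
      (univ.filter P).sigma fun _ => univ := by
    ext e; simp
  rw [this, card_sigma, sum_filter]
  simp

/-- The number of coordinates of each kind: `m` old ones (`true`) and `r` new ones (`false`). -/
def oldNew (m r : ℕ) (β : Bool) : ℕ := if β then m else r

open Finset in
/-- Each type occurs as often as there are cells of that type outside the corner. -/
theorem sum_typeCount {m r : ℕ} (a : Fin 3 → Fin (r ^ 2 + 2 * m * r) → ℕ)
    (ha : ∀ l, ∑ j, a l j = m ^ 2 * r)
    (hle : ∀ j, a 0 j + a 1 j + a 2 j ≤ m) (hge : ∀ j, 2 * m ≤ r + (a 0 j + a 1 j + a 2 j))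
    (β₁ β₂ β₃ : Bool) :
    ∑ s, typeCount m r a s β₁ β₂ β₃ = oldNew m r β₁ * (oldNew m r β₂ *
      (oldNew m r β₃ * if β₁ && β₂ && β₃ then 0 else 1)) := by
  have hpair : ∀ l l', (∀ j, a l j + a l' j ≤ m) →
      ∑ j, (m - (a l j + a l' j)) = m * (r * r) := by
    intro l l' h
    have : ∑ j, (m - (a l j + a l' j)) + (∑ j, a l j + ∑ j, a l' j) =
        ∑ _j : Fin (r ^ 2 + 2 * m * r), m := by
      rw [← sum_add_distrib, ← sum_add_distrib]
      exact sum_congr rfl fun j _ => Nat.sub_add_cancel (h j)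
    rw [ha, ha, sum_const, card_univ, Fintype.card_fin, smul_eq_mul] at this
    nlinarith
  rw [Fintype.sum_sum_type]
  cases β₁ <;> cases β₂ <;> cases β₃ <;> simp only [typeCount, oldNew, Bool.and_true, Bool.and_false,
    if_true, mul_one, mul_zero, sum_const_zero, zero_add, Bool.false_eq_true,
    if_false, ha]
  · have : ∑ j, (r + (a 0 j + a 1 j + a 2 j) - 2 * m) + ∑ _j : Fin (r ^ 2 + 2 * m * r), 2 * m =
        ∑ _j : Fin (r ^ 2 + 2 * m * r), r + (∑ j, a 0 j + ∑ j, a 1 j + ∑ j, a 2 j) := by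
      simp only [← sum_add_distrib]
      exact sum_congr rfl fun j _ => Nat.sub_add_cancel (hge j)
    simp only [ha, sum_const, card_univ, Fintype.card_fin, smul_eq_mul] at this ⊢
    nlinarith
  · rw [hpair 1 2 fun j => by have := hle j; omega]; ring
  · rw [hpair 0 2 fun j => by have := hle j; omega]; ring
  · ring
  · rw [hpair 0 1 fun j => by have := hle j; omega]
  · ring
  · ring

open Finset in
/-- A symbol that occurs at all in the old (new) layers of some direction outside the corner has
exactly `m` (`r`) cells there. The edge `e` excludes the corner symbols in the old layers. -/
theorem card_edge_color {m r N : ℕ} (a : Fin 3 → Fin N → ℕ)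
    (hle : ∀ j, a 0 j + a 1 j + a 2 j ≤ m) (hge : ∀ j, 2 * m ≤ r + (a 0 j + a 1 j + a 2 j))
    (e : Edge m r a) :
    #{e' : Edge m r a | e'.1.1 = e.1.1 ∧ e'.1.2.1 = e.1.2.1} = oldNew m r e.1.2.1 ∧
    #{e' : Edge m r a | e'.1.1 = e.1.1 ∧ e'.1.2.2.1 = e.1.2.2.1} = oldNew m r e.1.2.2.1 ∧
    #{e' : Edge m r a | e'.1.1 = e.1.1 ∧ e'.1.2.2.2 = e.1.2.2.2} = oldNew m r e.1.2.2.2 := by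
  obtain ⟨⟨s, β₁, β₂, β₃⟩, i⟩ := e
  have key : ∀ Q : Bool → Bool → Bool → Prop, ∀ [∀ x y z, Decidable (Q x y z)],
      #{e' : Edge m r a | e'.1.1 = s ∧ Q e'.1.2.1 e'.1.2.2.1 e'.1.2.2.2} =
        ∑ x, ∑ y, ∑ z, if Q x y z then typeCount m r a s x y z else 0 := by
    intro Q _
    rw [card_filter_sigma_fst (fun p : (Fin (m ^ 2) ⊕ Fin N) × Bool × Bool × Bool =>
      typeCount m r a p.1 p.2.1 p.2.2.1 p.2.2.2) fun p => p.1 = s ∧ Q p.2.1 p.2.2.1 p.2.2.2]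
    simp only [Fintype.sum_prod_type]
    rw [Fintype.sum_eq_single s]
    · simp
    · intro s' h
      simp [h]
  have hi := i.pos
  refine ⟨(key fun x _ _ => x = β₁).trans ?_, (key fun _ y _ => y = β₂).trans ?_,
    (key fun _ _ z => z = β₃).trans ?_⟩ <;> rcases s with s | j
  all_goals
    cases β₁ <;> cases β₂ <;> cases β₃ <;> simp [typeCount, oldNew] at hi ⊢
  all_goals
    have h1 := hle j
    have h2 := hge j
    omega

/-! ### Construction of the extension -/

/-- The coordinate in `{0, …, m + r - 1}` that is the `i`th one of its kind. -/
def coordVal (m : ℕ) (β : Bool) (i : ℕ) : ℕ := if β then i else m + i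

theorem coordVal_lt {m r i : ℕ} {β : Bool} (h : i < oldNew m r β) : coordVal m β i < m + r := by
  cases β <;> simp [oldNew, coordVal] at h ⊢ <;> omega

theorem coordVal_inj {m r i i' : ℕ} {β β' : Bool} (h : i < oldNew m r β)
    (h' : i' < oldNew m r β') (heq : coordVal m β i = coordVal m β' i') : β = β' ∧ i = i' := by
  cases β <;> cases β' <;> simp [oldNew, coordVal] at h h' heq ⊢ <;> omega

theorem exists_coordVal {m r : ℕ} (x : Fin (m + r)) :
    ∃ β, ∃ i < oldNew m r β, coordVal m β i = x := by
  have := x.isLt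
  by_cases h : (x : ℕ) < m
  · exact ⟨true, x, h, rfl⟩
  · refine ⟨false, x - m, ?_, ?_⟩ <;> simp only [oldNew, coordVal, Bool.false_eq_true, if_false] <;>
      omega

open Finset in
theorem exists_isLayerRainbow_extension {m r : ℕ} (hmr : m ≤ r) (L : CubeArray m)
    (hL : IsLayerRainbow L) :
    ∃ M : CubeArray (m + r), IsLayerRainbow M ∧ ∀ i j k : Fin m,
      (M (i.castAdd r) (j.castAdd r) (k.castAdd r) : ℕ) = L i j k := by
  obtain ⟨a, ha, hb⟩ := exists_balanced_triples hmr
  have hle := fun j => (hb j).1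
  have hge := fun j => (hb j).2
  have hn : m ^ 2 + (r ^ 2 + 2 * m * r) = (m + r) ^ 2 := by ring
  obtain ⟨f₁, f₂, f₃, hf, hi₁, hi₂, hi₃, hk⟩ := exists_three_coordinates (E := Edge m r a)
    (oldNew m r) (fun β₁ β₂ β₃ => if β₁ && β₂ && β₃ then 0 else 1) (fun e => e.1.1)
    (fun e => e.1.2.1) (fun e => e.1.2.2.1) (fun e => e.1.2.2.2)
    (fun e => (card_edge_color a hle hge e).1) (fun e => (card_edge_color a hle hge e).2.1)
    (fun e => (card_edge_color a hle hge e).2.2) (by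
      intro β₁ β₂ β₃
      rw [← sum_typeCount a ha hle hge, card_filter_sigma_fst
        (fun p : (Fin (m ^ 2) ⊕ Fin (r ^ 2 + 2 * m * r)) × Bool × Bool × Bool =>
          typeCount m r a p.1 p.2.1 p.2.2.1 p.2.2.2)
        fun p => p.2.1 = β₁ ∧ p.2.2.1 = β₂ ∧ p.2.2.2 = β₃]
      simp only [Fintype.sum_prod_type]
      refine sum_congr rfl fun s _ => ?_
      cases β₁ <;> cases β₂ <;> cases β₃ <;> simp)
  have hold : ∀ (e : Edge m r a) (s : Fin (m ^ 2)), e.1.1 = .inl s →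
      e.1.2.1 = false ∧ e.1.2.2.1 = false ∧ e.1.2.2.2 = false := by
    rintro ⟨⟨s', β₁, β₂, β₃⟩, i⟩ s rfl
    have := i.pos
    cases β₁ <;> cases β₂ <;> cases β₃ <;> simp [typeCount] at this ⊢
  let pos : (Fin m × Fin m × Fin m) ⊕ Edge m r a → Fin (m + r) × Fin (m + r) × Fin (m + r) :=
    Sum.elim (fun p => (p.1.castAdd r, p.2.1.castAdd r, p.2.2.castAdd r))
      (fun e => (⟨coordVal m e.1.2.1 (f₁ e), coordVal_lt (hf e).1⟩,
        ⟨coordVal m e.1.2.2.1 (f₂ e), coordVal_lt (hf e).2.1⟩,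
        ⟨coordVal m e.1.2.2.2 (f₃ e), coordVal_lt (hf e).2.2⟩))
  let col : (Fin m × Fin m × Fin m) ⊕ Edge m r a → Fin ((m + r) ^ 2) :=
    Sum.elim (fun p => Fin.cast hn ((L p.1 p.2.1 p.2.2).castAdd _))
      (fun e => Fin.cast hn (finSumFinEquiv e.1.1))
  have hcolE : ∀ e e' : Edge m r a, col (.inr e) = col (.inr e') → e.1.1 = e'.1.1 := by
    intro e e' h
    exact finSumFinEquiv.injective (Fin.cast_injective hn h)
  have hcolL : ∀ p p', col (.inl p) = col (.inl p') →
      L p.1 p.2.1 p.2.2 = L p'.1 p'.2.1 p'.2.2 := by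
    intro p p' h
    exact Fin.castAdd_injective _ _ (Fin.cast_injective hn h)
  have hcolLE : ∀ p e, col (.inl p) = col (.inr e) →
      e.1.2.1 = false ∧ e.1.2.2.1 = false ∧ e.1.2.2.2 = false := by
    intro p e h
    refine hold e (L p.1 p.2.1 p.2.2) (finSumFinEquiv.injective ?_)
    rw [finSumFinEquiv_apply_left]
    exact (Fin.cast_injective hn h).symm
  have hnot : ∀ e : Edge m r a, (e.1.2.1 && e.1.2.2.1 && e.1.2.2.2) = false := by
    rintro ⟨⟨s, β₁, β₂, β₃⟩, i⟩
    have := i.pos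
    rcases s with s | s <;> cases β₁ <;> cases β₂ <;> cases β₃ <;> simp [typeCount] at this ⊢
  have hlarge : ∀ (i : Fin m) (β : Bool) (k : ℕ), β = false → (i : ℕ) ≠ coordVal m β k := by
    rintro i _ k rfl
    have := i.isLt
    simp only [coordVal, Bool.false_eq_true, if_false]
    omega
  have hpos_inj : Function.Injective pos := by
    rintro (p | e) (p' | e') h
    · simpa [pos, Prod.ext_iff] using h
    · exfalso
      have h1 := congrArg (fun q => (q.1 : ℕ)) h
      have h2 := congrArg (fun q => (q.2.1 : ℕ)) h
      have h3 := congrArg (fun q => (q.2.2 : ℕ)) h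
      rcases Bool.and_eq_false_iff.1 (hnot e') with h0 | h0
      · rcases Bool.and_eq_false_iff.1 h0 with h0 | h0
        · exact hlarge _ _ _ h0 h1
        · exact hlarge _ _ _ h0 h2
      · exact hlarge _ _ _ h0 h3
    · exfalso
      have h1 := congrArg (fun q => (q.1 : ℕ)) h.symm
      have h2 := congrArg (fun q => (q.2.1 : ℕ)) h.symm
      have h3 := congrArg (fun q => (q.2.2 : ℕ)) h.symm
      rcases Bool.and_eq_false_iff.1 (hnot e) with h0 | h0
      · rcases Bool.and_eq_false_iff.1 h0 with h0 | h0
        · exact hlarge _ _ _ h0 h1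
        · exact hlarge _ _ _ h0 h2
      · exact hlarge _ _ _ h0 h3
    · have h1 := coordVal_inj (hf e).1 (hf e').1 (congrArg (fun q => (q.1 : ℕ)) h)
      have h2 := coordVal_inj (hf e).2.1 (hf e').2.1 (congrArg (fun q => (q.2.1 : ℕ)) h)
      have h3 := coordVal_inj (hf e).2.2 (hf e').2.2 (congrArg (fun q => (q.2.2 : ℕ)) h)
      have hcard := hk e.1.2.1 e.1.2.2.1 e.1.2.2.2 _ (hf e).1 _ (hf e).2.1 _ (hf e).2.2
      rw [hnot e] at hcard
      have := card_le_one.1 hcard.le e (by simp) e' (by simp [h1, h2, h3])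
      rw [this]
  have hpos_surj : Function.Surjective pos := by
    rintro ⟨x, y, z⟩
    obtain ⟨β₁, i₁, h1, hx⟩ := exists_coordVal x
    obtain ⟨β₂, i₂, h2, hy⟩ := exists_coordVal y
    obtain ⟨β₃, i₃, h3, hz⟩ := exists_coordVal z
    by_cases hβ : (β₁ && β₂ && β₃) = true
    · simp only [Bool.and_eq_true] at hβ
      obtain ⟨⟨rfl, rfl⟩, rfl⟩ := hβ
      exact ⟨.inl (⟨i₁, h1⟩, ⟨i₂, h2⟩, ⟨i₃, h3⟩),
        Prod.ext (Fin.ext hx) (Prod.ext (Fin.ext hy) (Fin.ext hz))⟩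
    · have hcard := hk β₁ β₂ β₃ i₁ h1 i₂ h2 i₃ h3
      rw [if_neg hβ] at hcard
      obtain ⟨e, he⟩ := card_pos.1 (hcard.symm ▸ Nat.one_pos)
      obtain ⟨-, ⟨⟨rfl, rfl⟩, rfl, rfl⟩, rfl, rfl⟩ := mem_filter.1 he
      exact ⟨.inr e, Prod.ext (Fin.ext hx) (Prod.ext (Fin.ext hy) (Fin.ext hz))⟩
  let φ := Equiv.ofBijective pos ⟨hpos_inj, hpos_surj⟩
  refine ⟨fun x y z => col (φ.symm (x, y, z)),
    isLayerRainbow_of_bijective φ col ?_ ?_ ?_, fun i j k => ?_⟩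
  · rintro (p | e) (p' | e') h <;> obtain ⟨hc, hx⟩ := Prod.ext_iff.1 h
    · obtain ⟨x, y, z⟩ := p
      obtain ⟨x', y', z'⟩ := p'
      obtain rfl : x = x' := Fin.castAdd_injective _ _ hx
      have := (hL.layer_fst x _).unique (y₁ := (y, z)) (y₂ := (y', z')) rfl (hcolL _ _ hc).symm
      obtain ⟨rfl, rfl⟩ := Prod.ext_iff.1 this
      rfl
    · exact (hlarge _ _ _ (hcolLE _ _ hc).1 (congrArg Fin.val hx)).elim
    · exact (hlarge _ _ _ (hcolLE _ _ hc.symm).1 (congrArg Fin.val hx.symm)).elim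
    · have h1 := coordVal_inj (hf e).1 (hf e').1 (congrArg Fin.val hx)
      rw [hi₁ e e' (hcolE _ _ hc) h1.1 h1.2]
  · rintro (p | e) (p' | e') h <;> obtain ⟨hc, hx⟩ := Prod.ext_iff.1 h
    · obtain ⟨x, y, z⟩ := p
      obtain ⟨x', y', z'⟩ := p'
      obtain rfl : y = y' := Fin.castAdd_injective _ _ hx
      have := (hL.layer_snd y _).unique (y₁ := (x, z)) (y₂ := (x', z')) rfl (hcolL _ _ hc).symm
      obtain ⟨rfl, rfl⟩ := Prod.ext_iff.1 this
      rfl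
    · exact (hlarge _ _ _ (hcolLE _ _ hc).2.1 (congrArg Fin.val hx)).elim
    · exact (hlarge _ _ _ (hcolLE _ _ hc.symm).2.1 (congrArg Fin.val hx.symm)).elim
    · have h1 := coordVal_inj (hf e).2.1 (hf e').2.1 (congrArg Fin.val hx)
      rw [hi₂ e e' (hcolE _ _ hc) h1.1 h1.2]
  · rintro (p | e) (p' | e') h <;> obtain ⟨hc, hx⟩ := Prod.ext_iff.1 h
    · obtain ⟨x, y, z⟩ := p
      obtain ⟨x', y', z'⟩ := p'
      obtain rfl : z = z' := Fin.castAdd_injective _ _ hx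
      have := (hL.layer_trd z _).unique (y₁ := (x, y)) (y₂ := (x', y')) rfl (hcolL _ _ hc).symm
      obtain ⟨rfl, rfl⟩ := Prod.ext_iff.1 this
      rfl
    · exact (hlarge _ _ _ (hcolLE _ _ hc).2.2 (congrArg Fin.val hx)).elim
    · exact (hlarge _ _ _ (hcolLE _ _ hc.symm).2.2 (congrArg Fin.val hx.symm)).elim
    · have h1 := coordVal_inj (hf e).2.2 (hf e').2.2 (congrArg Fin.val hx)
      rw [hi₃ e e' (hcolE _ _ hc) h1.1 h1.2]
  · have : φ.symm (i.castAdd r, j.castAdd r, k.castAdd r) = .inl (i, j, k) :=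
      φ.symm_apply_eq.2 rfl
    exact (congrArg (fun e => (col e : ℕ)) this).trans rfl

theorem theorem1 (m n : ℕ) (hm : 1 ≤ m) (L : CubeArray m) (hL : IsLayerRainbow L) :
    (∃ M : CubeArray n, IsLayerRainbow M ∧ ProperlyExtends L M) ↔ 2 * m ≤ n := by
  constructor
  · rintro ⟨M, hM, h⟩
    exact two_mul_le_of_properlyExtends hL hM h
  · intro h
    obtain ⟨r, rfl⟩ := Nat.exists_eq_add_of_le (show m ≤ n by omega)
    obtain ⟨M, hM, h⟩ := exists_isLayerRainbow_extension (show m ≤ r by omega) L hL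
    exact ⟨M, hM, by omega, h⟩
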